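/- Let $F=GF(q)$ with $q$ a power of an odd prime, let $n\ge 1$, and let $V=F^{2n}=\{(x,y): x,y\in F^n\}$ (row vectors) carry the symplectic form $\varphi((x_1,y_1),(x_2,y_2))=x_1y_2^{T}-y_1x_2^{T}$. Let $\mathrm{Sp}(2n,q)$ be its isometry group, a group of matrices acting on $V$ from the right. Let $B$ be the subgroup of the matrices $g_Q=\begin{bmatrix} I&0\\ Q&I\end{bmatrix}$ with $Q$ a symmetric $n\times n$ matrix over $F$, and let $G=\langle -I\rangle B$. Fix a nontrivial additive character $\psi:F\to\mathbb{C}^{\times}$ (for example the canonical one). For $v=(x,y)\in V$ let $T_v$ be the operator on the space of functions $f:F^n\to\mathbb{C}$ given by $(T_vf)(t)=\psi(xt^{T}-\tfrac12xy^{T})\,f(t-y)$; these satisfy $T_uT_v=\psi(\tfrac12\varphi(u,v))\,T_{u+v}$. A Weil representation of $\mathrm{Sp}(2n,q)$ (attached to $\psi$) is a representation $W$ of $\mathrm{Sp}(2n,q)$ on this $q^n$-dimensional space with $W(g)^{-1}T_vW(g)=T_{vg}$ for all $g\in \mathrm{Sp}(2n,q)$ and $v\in V$. Then: 1. $G=\langle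 -I\rangle\times B$ is an internal direct product, and $G$ is a maximal abelian subgroup of $\mathrm{Sp}(2n,q)$. 2. A Weil representation of $\mathrm{Sp}(2n,q)$ attached to $\psi$ exists, and $G$ is Weil-free: for every Weil representation $W$, with character $\omega$, every irreducible constituent of $\omega|G$ has multiplicity $1$. -/

import Mathlib

open Matrix

universe u w

/-- The group `Sp(2n, F)` of `2n × 2n` matrices `A` with `A J Aᵀ = J`; it acts on row vectors
`v : Fin n ⊕ Fin n → F` from the right, `v ↦ v ᵥ* A`. -/
abbrev Sp (n : ℕ) (F : Type u) [Field F] : Type u :=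
  Matrix.symplecticGroup (Fin n) F

/-- The symplectic form `φ((x₁, y₁), (x₂, y₂)) = x₁ y₂ᵀ - y₁ x₂ᵀ`; a row vector `v` is the pair
`(x, y)` with `x = v ∘ Sum.inl` and `y = v ∘ Sum.inr`. -/
def sympForm {n : ℕ} {F : Type u} [Field F] (v₁ v₂ : Fin n ⊕ Fin n → F) : F :=
  (v₁ ∘ Sum.inl) ⬝ᵥ (v₂ ∘ Sum.inr) - (v₁ ∘ Sum.inr) ⬝ᵥ (v₂ ∘ Sum.inl)

/-- `sympForm` has the matrix with block rows `(0, I)` and `(-I, 0)`, which is the negative of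
Mathlib's `J`. -/
theorem sympForm_eq {n : ℕ} {F : Type u} [Field F] (v₁ v₂ : Fin n ⊕ Fin n → F) :
    sympForm v₁ v₂ = v₁ ⬝ᵥ ((Matrix.fromBlocks 0 1 (-1) 0) *ᵥ v₂) := by
  simp [sympForm, dotProduct, Matrix.fromBlocks_mulVec, Fintype.sum_sum_type, sub_eq_add_neg,
    Matrix.neg_mulVec]

/-- The Weyl (Heisenberg) operators of the Schrödinger model on the functions `Fⁿ → ℂ`: for
`v = (x, y)`, `(T_v f)(t) = ψ(x tᵀ - x yᵀ / 2) f(t - y)`.  With `z ↦ ψ(z)` on the centre they form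
the irreducible representation with central character `ψ` of the Heisenberg group of
`(V, sympForm)`; see `weyl_mul`. -/
noncomputable def weyl {n : ℕ} {F : Type u} [Field F] (ψ : AddChar F ℂ)
    (v : Fin n ⊕ Fin n → F) : ((Fin n → F) → ℂ) →ₗ[ℂ] ((Fin n → F) → ℂ) where
  toFun f := fun t =>
    ψ ((v ∘ Sum.inl) ⬝ᵥ t - 2⁻¹ * ((v ∘ Sum.inl) ⬝ᵥ (v ∘ Sum.inr))) * f (t - v ∘ Sum.inr)
  map_add' f g := by
    funext t
    simp [mul_add]
  map_smul' c f := by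
    funext t
    simp [mul_left_comm]

/-- The Heisenberg relations `T_u T_v = ψ(φ(u, v) / 2) T_{u + v}` in odd characteristic. -/
theorem weyl_mul {n : ℕ} {F : Type u} [Field F] (h2 : (2 : F) ≠ 0) (ψ : AddChar F ℂ)
    (v₁ v₂ : Fin n ⊕ Fin n → F) :
    weyl ψ v₁ ∘ₗ weyl ψ v₂ = ψ (2⁻¹ * sympForm v₁ v₂) • weyl ψ (v₁ + v₂) := by
  refine LinearMap.ext fun f => funext fun t => ?_
  have e1 : (v₁ + v₂) ∘ Sum.inl = v₁ ∘ Sum.inl + v₂ ∘ Sum.inl := rfl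
  have e2 : (v₁ + v₂) ∘ Sum.inr = v₁ ∘ Sum.inr + v₂ ∘ Sum.inr := rfl
  simp only [LinearMap.comp_apply, LinearMap.smul_apply, Pi.smul_apply, smul_eq_mul, weyl,
    LinearMap.coe_mk, AddHom.coe_mk, sympForm, e1, e2]
  rw [← mul_assoc, ← mul_assoc, ← AddChar.map_add_eq_mul, ← AddChar.map_add_eq_mul, sub_sub]
  congr 2
  simp only [dotProduct_sub, dotProduct_add, add_dotProduct,
    dotProduct_comm (v₁ ∘ Sum.inr) (v₂ ∘ Sum.inl)]
  field_simp
  ring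

/-- `W` is a Weil representation of `Sp(2n, F)` attached to the additive character `ψ`: an honest
(not only projective) representation on the space of the Schrödinger model which implements the
right action of `Sp(2n, F)` on the Weyl operators, `W(g)⁻¹ T_v W(g) = T_{v g}`. -/
def IsWeilRepresentation {n : ℕ} {F : Type u} [Field F] (ψ : AddChar F ℂ)
    (W : Representation ℂ (Sp n F) ((Fin n → F) → ℂ)) : Prop :=
  ∀ (g : Sp n F) (v : Fin n ⊕ Fin n → F),
    weyl ψ v ∘ₗ W g = W g ∘ₗ weyl ψ (v ᵥ* (g : Matrix (Fin n ⊕ Fin n) (Fin n ⊕ Fin n) F))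

/-- The element `-I` of `Sp(2n, F)`. -/
def Sp.negOne (n : ℕ) (F : Type u) [Field F] : Sp n F :=
  ⟨-1, SymplecticGroup.neg_mem (one_mem _)⟩

/-- The symplectic matrix `g_Q` with block rows `(I, 0)` and `(Q, I)`, for `Q` symmetric. -/
def Sp.unip {n : ℕ} {F : Type u} [Field F] (Q : Matrix (Fin n) (Fin n) F) (hQ : Q.IsSymm) :
    Sp n F :=
  ⟨Matrix.fromBlocks 1 0 Q 1, by
    rw [SymplecticGroup.mem_iff, Matrix.J, Matrix.fromBlocks_multiply,
      Matrix.fromBlocks_transpose, Matrix.fromBlocks_multiply]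
    simp [hQ.eq]⟩

/-- The subgroup `B` of `Sp(2n, F)` that consists of all `g_Q`, `Q` symmetric. -/
def Sp.B (n : ℕ) (F : Type u) [Field F] : Subgroup (Sp n F) where
  carrier := {g | ∃ (Q : Matrix (Fin n) (Fin n) F) (hQ : Q.IsSymm), g = Sp.unip Q hQ}
  one_mem' := ⟨0, Matrix.isSymm_zero, Subtype.ext (by simp [Sp.unip])⟩
  mul_mem' := by
    rintro _ _ ⟨Q, hQ, rfl⟩ ⟨R, hR, rfl⟩
    exact ⟨Q + R, hQ.add hR, Subtype.ext (by simp [Sp.unip, Matrix.fromBlocks_multiply])⟩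
  inv_mem' := by
    rintro _ ⟨Q, hQ, rfl⟩
    refine ⟨-Q, hQ.neg, ?_⟩
    rw [inv_eq_iff_mul_eq_one]
    exact Subtype.ext (by simp [Sp.unip, Matrix.fromBlocks_multiply])

/-- The subgroup `G = ⟨-I⟩ B` of `Sp(2n, F)`. -/
def Sp.G (n : ℕ) (F : Type u) [Field F] : Subgroup (Sp n F) :=
  Subgroup.zpowers (Sp.negOne n F) ⊔ Sp.B n F

/-- Every irreducible constituent `σ` of the complex representation `π` (an irreducible
representation with a nonzero intertwining map to `π`) has multiplicity `dim Hom(σ, π) = 1`. -/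
def IsMultiplicityFree {H : Type u} [Group H] {V : Type w} [AddCommGroup V] [Module ℂ V]
    (π : Representation ℂ H V) : Prop :=
  ∀ (E : Type w) [AddCommGroup E] [Module ℂ E] (σ : Representation ℂ H E),
    σ.IsIrreducible → (∃ f : Representation.IntertwiningMap σ π, f ≠ 0) →
      Module.finrank ℂ (Representation.IntertwiningMap σ π) = 1

/-! Existence: the operators `weyl ψ v` form a basis of the endomorphism algebra. Since `g`
preserves the symplectic form, `T_v ↦ T_{vg}` extends to an algebra automorphism, which is inner
(Skolem–Noether); the conjugating operator is unique up to a scalar by Schur's lemma. This gives a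
projective representation commuting with the parity operator `P`. As `P` has trace `1`, its
`±1`-eigenspaces have dimensions `d + 1` and `d`, so the quotient of the determinants on them is
multiplicative on the implementers and sends a nonzero scalar `c` to `c`. Dividing by it yields an
honest representation (`exists_linearization`).

Multiplicity one: `W(g_Q)` is, up to a constant, multiplication by `ψ(-tQtᵀ/2)`. The quadratic forms
separate points up to sign, so a common eigenvector of `B` lives on some `{s, -s}`; since `W(-I)` is
a multiple of parity, its values at `s` and `-s` determine each other
(`IsWeilRepresentation.eq_zero_of_eigenvector`).

Maximality: the centralizer of `B` is already contained in `G` (`Sp.mem_G_of_commute`). -/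

/-! ### Rescaling projective representations by determinants -/

section Linearization

variable {V : Type*} [AddCommGroup V] [Module ℂ V]

/-- An endomorphism commuting with `P` preserves the eigenspaces of `P`. -/
theorem Commute.mapsTo_ker_sub_smul_one {A P : Module.End ℂ V} (h : Commute A P) (c : ℂ) :
    Set.MapsTo A (LinearMap.ker (P - c • 1)) (LinearMap.ker (P - c • 1)) := by
  intro x hx
  have hx' : P x = c • x := by simpa [sub_eq_zero] using hx
  have : P (A x) = A (P x) := (LinearMap.congr_fun h.eq x).symm
  simp [this, hx']

open Classical in
/-- The determinant of `A` on the `c`-eigenspace of a `P` that commutes with `A`. -/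
noncomputable def eigenDet (P : Module.End ℂ V) (c : ℂ) (A : Module.End ℂ V) : ℂ :=
  if h : Commute A P then LinearMap.det (A.restrict (h.mapsTo_ker_sub_smul_one c)) else 0

theorem eigenDet_mul {P A B : Module.End ℂ V} (c : ℂ) (hA : Commute A P) (hB : Commute B P) :
    eigenDet P c (A * B) = eigenDet P c A * eigenDet P c B := by
  rw [eigenDet, eigenDet, eigenDet, dif_pos hA, dif_pos hB, dif_pos (hA.mul_left hB), ← map_mul]
  rfl

theorem eigenDet_smul_one (P : Module.End ℂ V) (c a : ℂ) :
    eigenDet P c (a • 1) = a ^ Module.finrank ℂ (LinearMap.ker (P - c • 1)) := by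
  have h : Commute (a • 1 : Module.End ℂ V) P := (Commute.one_left P).smul_left a
  rw [eigenDet, dif_pos h]
  have : (a • 1 : Module.End ℂ V).restrict (h.mapsTo_ker_sub_smul_one c) = a • 1 := by
    ext x; rfl
  rw [this, LinearMap.det_smul, map_one, mul_one]

/-- The eigenspaces of an involution of trace `1` have dimensions that differ by `1`. -/
theorem finrank_eigenspace_of_involution [FiniteDimensional ℂ V] {P : Module.End ℂ V}
    (hP : P * P = 1) (htr : LinearMap.trace ℂ V P = 1) :
    Module.finrank ℂ (LinearMap.ker (P - (1 : ℂ) • 1)) =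
      Module.finrank ℂ (LinearMap.ker (P - (-1 : ℂ) • 1)) + 1 := by
  have hPx : ∀ x, P (P x) = x := fun x => LinearMap.congr_fun hP x
  have h₁ : LinearMap.IsProj (LinearMap.ker (P - (1 : ℂ) • 1)) ((2⁻¹ : ℂ) • (1 + P)) := by
    refine ⟨fun x => ?_, fun x hx => ?_⟩
    · simp [hPx, add_comm]
    · have hx' : P x = x := by simpa [sub_eq_zero] using hx
      simp only [LinearMap.smul_apply, LinearMap.add_apply, Module.End.one_apply, hx']
      module
  have h₂ : LinearMap.IsProj (LinearMap.ker (P - (-1 : ℂ) • 1)) ((2⁻¹ : ℂ) • (1 - P)) := by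
    refine ⟨fun x => ?_, fun x hx => ?_⟩
    · simp [hPx]
    · have hx' : P x = -x := by simpa [add_eq_zero_iff_eq_neg] using hx
      simp only [LinearMap.smul_apply, LinearMap.sub_apply, Module.End.one_apply, hx']
      module
  have e₁ := h₁.trace
  have e₂ := h₂.trace
  rw [map_smul, map_add, htr, smul_eq_mul] at e₁
  rw [map_smul, map_sub, htr, smul_eq_mul] at e₂
  have : ((Module.finrank ℂ (LinearMap.ker (P - (1 : ℂ) • 1)) : ℕ) : ℂ) =
      ((Module.finrank ℂ (LinearMap.ker (P - (-1 : ℂ) • 1)) + 1 : ℕ) : ℂ) := by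
    push_cast
    rw [← e₁, ← e₂]
    ring
  exact_mod_cast this

/-- On the centralizer of an involution of trace `1` there is a multiplicative function that
restricts to the identity on the scalars. -/
theorem exists_multiplicative_scalar_section [FiniteDimensional ℂ V] {P : Module.End ℂ V}
    (hP : P * P = 1) (htr : LinearMap.trace ℂ V P = 1) :
    ∃ χ : Module.End ℂ V → ℂ, (∀ A B, Commute A P → Commute B P → χ (A * B) = χ A * χ B) ∧
      ∀ c : ℂ, c ≠ 0 → χ (c • 1) = c := by
  -- On a scalar `c` this is `c ^ (d + 1) / c ^ d = c`.
  refine ⟨fun A => eigenDet P 1 A / eigenDet P (-1) A, fun A B hA hB => ?_, fun c hc => ?_⟩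
  · simp only [eigenDet_mul _ hA hB]
    rw [mul_div_mul_comm]
  · simp only [eigenDet_smul_one, finrank_eigenspace_of_involution hP htr]
    rw [pow_succ, mul_div_assoc, mul_comm, div_mul_cancel₀ _ (pow_ne_zero _ hc)]

/-- A projective representation that commutes with an involution of trace `1` can be rescaled to
an honest representation. -/
theorem exists_linearization [FiniteDimensional ℂ V] {P : Module.End ℂ V}
    (hP : P * P = 1) (htr : LinearMap.trace ℂ V P = 1) {H : Type*} [Group H]
    (M : H → Module.End ℂ V) (hM : ∀ g, IsUnit (M g)) (hMP : ∀ g, Commute (M g) P)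
    (hmul : ∀ g h, ∃ c : ℂ, M g * M h = c • M (g * h)) :
    ∃ W : Representation ℂ H V, ∀ g, ∃ c : ℂ, W g = c • M g := by
  have hV : Nontrivial V := by
    by_contra h
    rw [not_nontrivial_iff_subsingleton] at h
    rw [Subsingleton.elim P 0, map_zero] at htr
    exact zero_ne_one htr
  obtain ⟨χ, χmul, χc⟩ := exists_multiplicative_scalar_section hP htr
  have χone : χ 1 = 1 := by simpa using χc 1 one_ne_zero
  have χne : ∀ g, χ (M g) ≠ 0 := by
    intro g h0
    obtain ⟨U, hU⟩ := hM g
    have hc : Commute (↑U⁻¹ : Module.End ℂ V) P := (hU ▸ hMP g).units_inv_left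
    have := χmul (M g) ↑U⁻¹ (hMP g) hc
    rw [← hU, Units.mul_inv, hU, h0, χone, zero_mul] at this
    exact one_ne_zero this
  have key : ∀ g h, (χ (M (g * h)))⁻¹ • M (g * h) =
      ((χ (M g))⁻¹ • M g) * ((χ (M h))⁻¹ • M h) := by
    intro g h
    obtain ⟨c, hc⟩ := hmul g h
    have hc0 : c ≠ 0 := by
      rintro rfl
      rw [zero_smul] at hc
      exact ((hM g).mul (hM h)).ne_zero hc
    have e : χ (M g) * χ (M h) = c * χ (M (g * h)) := by
      rw [← χmul _ _ (hMP g) (hMP h), hc, ← one_mul (M (g * h)), ← smul_mul_assoc,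
        χmul _ _ ((Commute.one_left P).smul_left c) (hMP _), χc c hc0, one_mul]
    rw [smul_mul_smul_comm, hc, ← mul_inv, e, smul_smul, mul_inv, mul_right_comm,
      inv_mul_cancel₀ hc0, one_mul]
  have hunit : IsUnit ((χ (M 1))⁻¹ • M 1) := (hM 1).smul (Units.mk0 _ (inv_ne_zero (χne 1)))
  refine ⟨{ toFun := fun g => (χ (M g))⁻¹ • M g, map_one' := ?_, map_mul' := key },
    fun g => ⟨_, rfl⟩⟩
  -- The rescaled operator at `1` is an invertible idempotent, hence the identity.
  have := key 1 1
  rw [mul_one] at this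
  exact hunit.mul_left_cancel (this.symm.trans (mul_one _).symm)

end Linearization

/-! ### Weyl operators and existence of the Weil representation -/

section Weyl

variable {n : ℕ} {F : Type u} [Field F]

theorem weyl_apply (ψ : AddChar F ℂ) (v : Fin n ⊕ Fin n → F) (f : (Fin n → F) → ℂ)
    (t : Fin n → F) :
    weyl ψ v f t = ψ ((v ∘ Sum.inl) ⬝ᵥ t - 2⁻¹ * ((v ∘ Sum.inl) ⬝ᵥ (v ∘ Sum.inr))) *
      f (t - v ∘ Sum.inr) := rfl

theorem weyl_zero (ψ : AddChar F ℂ) : weyl ψ (0 : Fin n ⊕ Fin n → F) = 1 := by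
  refine LinearMap.ext fun f => funext fun t => ?_
  simp [weyl_apply, Pi.zero_comp]

theorem weyl_mul' (h2 : (2 : F) ≠ 0) (ψ : AddChar F ℂ) (u v : Fin n ⊕ Fin n → F) :
    weyl ψ u * weyl ψ v = ψ (2⁻¹ * sympForm u v) • weyl ψ (u + v) :=
  weyl_mul h2 ψ u v

theorem sum_addChar_dotProduct [Fintype F] [DecidableEq F] {ψ : AddChar F ℂ} (hψ : ψ ≠ 1)
    (t : Fin n → F) :
    ∑ x : Fin n → F, ψ (x ⬝ᵥ t) = if t = 0 then (Fintype.card (Fin n → F) : ℂ) else 0 := by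
  split_ifs with ht
  · simp [ht]
  · let χ : AddChar (Fin n → F) ℂ :=
      { toFun := fun x => ψ (x ⬝ᵥ t)
        map_zero_eq_one' := by simp
        map_add_eq_mul' := fun x y => by rw [add_dotProduct, AddChar.map_add_eq_mul] }
    have hχ : χ ≠ 1 := by
      intro h
      obtain ⟨i, hi⟩ := Function.ne_iff.1 ht
      obtain ⟨a, ha⟩ := AddChar.ne_one_iff.1 hψ
      have := DFunLike.congr_fun h (Pi.single i (a / t i))
      refine ha ?_
      simpa [χ, single_dotProduct, div_mul_cancel₀ _ hi] using this
    exact AddChar.sum_eq_zero_of_ne_one hχ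

/-- The matrix units of the endomorphisms of the functions on `Fⁿ`. -/
noncomputable def matrixUnit (s r : Fin n → F) : Module.End ℂ ((Fin n → F) → ℂ) :=
  open Classical in LinearMap.single ℂ (fun _ => ℂ) s ∘ₗ LinearMap.proj r

/-- Fourier inversion: with the translation `s - r` fixed, summing over the modulation `x` isolates
the point `t = s`. -/
theorem card_smul_matrixUnit [Fintype F] {ψ : AddChar F ℂ} (hψ : ψ ≠ 1) (s r : Fin n → F) :
    (Fintype.card (Fin n → F) : ℂ) • matrixUnit s r =
      ∑ x : Fin n → F, ψ (2⁻¹ * (x ⬝ᵥ (s - r)) - x ⬝ᵥ s) • weyl ψ (Sum.elim x (s - r)) := by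
  classical
  refine LinearMap.ext fun f => funext fun t => ?_
  have : ∀ x : Fin n → F, ψ (2⁻¹ * (x ⬝ᵥ (s - r)) - x ⬝ᵥ s) *
      (ψ (x ⬝ᵥ t - 2⁻¹ * (x ⬝ᵥ (s - r))) * f (t - (s - r))) =
      ψ (x ⬝ᵥ (t - s)) * f (t - (s - r)) := by
    intro x
    rw [← mul_assoc, ← AddChar.map_add_eq_mul, dotProduct_sub x t s]
    congr 2
    ring
  simp only [LinearMap.smul_apply, LinearMap.sum_apply, Finset.sum_apply, Pi.smul_apply,
    smul_eq_mul, weyl_apply, Sum.elim_comp_inl, Sum.elim_comp_inr, this, ← Finset.sum_mul,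
    sum_addChar_dotProduct hψ, sub_eq_zero]
  by_cases h : t = s
  · subst h
    simp [matrixUnit]
  · simp [matrixUnit, h]

theorem span_weyl [Finite F] {ψ : AddChar F ℂ} (hψ : ψ ≠ 1) :
    Submodule.span ℂ (Set.range (weyl (n := n) ψ)) = ⊤ := by
  classical
  have := Fintype.ofFinite F
  rw [Submodule.eq_top_iff']
  intro A
  have hA : A = ∑ s : Fin n → F, ∑ r : Fin n → F,
      (A (fun j => if r = j then 1 else 0) s) • matrixUnit s r := by
    refine LinearMap.ext fun f => funext fun t => ?_
    rw [LinearMap.pi_apply_eq_sum_univ A f]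
    simp [matrixUnit, LinearMap.sum_apply, Finset.sum_apply, Pi.single_apply, mul_comm]
  rw [hA]
  refine Submodule.sum_mem _ fun s _ => Submodule.sum_mem _ fun r _ => Submodule.smul_mem _ _ ?_
  have hc : (Fintype.card (Fin n → F) : ℂ) ≠ 0 := Nat.cast_ne_zero.2 Fintype.card_ne_zero
  rw [← Submodule.smul_mem_iff _ hc, card_smul_matrixUnit hψ]
  exact Submodule.sum_mem _ fun x _ => Submodule.smul_mem _ _ (Submodule.subset_span ⟨_, rfl⟩)

/-- The Weyl operators as a basis of the space of all endomorphisms. -/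
noncomputable def weylBasis [Fintype F] {ψ : AddChar F ℂ} (hψ : ψ ≠ 1) :
    Module.Basis (Fin n ⊕ Fin n → F) ℂ (Module.End ℂ ((Fin n → F) → ℂ)) :=
  open Classical in
  basisOfTopLeSpanOfCardEqFinrank (weyl ψ) (span_weyl hψ).ge (by
    rw [Module.finrank_linearMap, Module.finrank_fintype_fun_eq_card]
    simp [pow_add])

theorem weylBasis_apply [Fintype F] {ψ : AddChar F ℂ} (hψ : ψ ≠ 1) (v : Fin n ⊕ Fin n → F) :
    weylBasis hψ v = weyl ψ v := by
  simp [weylBasis]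

/-- Schur's lemma for the Weyl operators. -/
theorem eq_smul_one_of_commute_weyl [Finite F] {ψ : AddChar F ℂ} (hψ : ψ ≠ 1)
    {A : Module.End ℂ ((Fin n → F) → ℂ)} (hA : ∀ v, Commute A (weyl ψ v)) :
    ∃ c : ℂ, A = c • 1 := by
  have hc : A ∈ Subalgebra.center ℂ (Module.End ℂ ((Fin n → F) → ℂ)) := by
    rw [Subalgebra.mem_center_iff]
    intro B
    have hB : B ∈ Submodule.span ℂ (Set.range (weyl (n := n) ψ)) := by
      rw [span_weyl hψ]; trivial
    induction hB using Submodule.span_induction with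
    | mem x hx => obtain ⟨v, rfl⟩ := hx; exact (hA v).eq.symm
    | zero => simp
    | add x y _ _ hx hy => rw [add_mul, mul_add, hx, hy]
    | smul a x _ hx => rw [smul_mul_assoc, mul_smul_comm, hx]
  rw [Algebra.IsCentral.center_eq_bot, Algebra.mem_bot] at hc
  obtain ⟨c, hc⟩ := hc
  exact ⟨c, by rw [← hc, Algebra.algebraMap_eq_smul_one]⟩

theorem sympForm_vecMul (g : Sp n F) (u v : Fin n ⊕ Fin n → F) :
    sympForm (u ᵥ* (g : Matrix (Fin n ⊕ Fin n) (Fin n ⊕ Fin n) F))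
      (v ᵥ* (g : Matrix (Fin n ⊕ Fin n) (Fin n ⊕ Fin n) F)) = sympForm u v := by
  have hJ : (Matrix.fromBlocks 0 1 (-1) 0 : Matrix (Fin n ⊕ Fin n) (Fin n ⊕ Fin n) F) =
      -Matrix.J (Fin n) F := by
    simp [Matrix.J, Matrix.fromBlocks_neg]
  have hg := SymplecticGroup.mem_iff.1 g.2
  have hv : v ᵥ* (g : Matrix (Fin n ⊕ Fin n) (Fin n ⊕ Fin n) F) = (g : Matrix _ _ F)ᵀ *ᵥ v :=
    (mulVec_transpose _ _).symm
  rw [sympForm_eq, sympForm_eq, hJ, hv, mulVec_mulVec,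
    ← dotProduct_mulVec, mulVec_mulVec, ← mul_assoc, mul_neg, neg_mul, hg]

/-- The right action of a symplectic matrix as a permutation of the vectors. -/
def vecMulEquiv (g : Sp n F) : (Fin n ⊕ Fin n → F) ≃ (Fin n ⊕ Fin n → F) where
  toFun v := v ᵥ* (g : Matrix (Fin n ⊕ Fin n) (Fin n ⊕ Fin n) F)
  invFun v := v ᵥ* ((g⁻¹ : Sp n F) : Matrix (Fin n ⊕ Fin n) (Fin n ⊕ Fin n) F)
  left_inv v := by
    change _ ᵥ* _ ᵥ* _ = v
    rw [vecMul_vecMul, ← Submonoid.coe_mul, mul_inv_cancel, Submonoid.coe_one, vecMul_one]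
  right_inv v := by
    change _ ᵥ* _ ᵥ* _ = v
    rw [vecMul_vecMul, ← Submonoid.coe_mul, inv_mul_cancel, Submonoid.coe_one, vecMul_one]

/-- The automorphism `T_v ↦ T_{v g}` of the endomorphism algebra. -/
theorem exists_algEquiv_weyl [Finite F] (h2 : (2 : F) ≠ 0) {ψ : AddChar F ℂ} (hψ : ψ ≠ 1)
    (g : Sp n F) :
    ∃ α : Module.End ℂ ((Fin n → F) → ℂ) ≃ₐ[ℂ] Module.End ℂ ((Fin n → F) → ℂ),
      ∀ v, α (weyl ψ v) = weyl ψ (v ᵥ* (g : Matrix (Fin n ⊕ Fin n) (Fin n ⊕ Fin n) F)) := by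
  have := Fintype.ofFinite F
  let b := weylBasis (n := n) hψ
  let α := b.equiv b (vecMulEquiv g)
  have hα : ∀ v, α (weyl ψ v) =
      weyl ψ (v ᵥ* (g : Matrix (Fin n ⊕ Fin n) (Fin n ⊕ Fin n) F)) := by
    intro v
    have := b.equiv_apply v b (vecMulEquiv g)
    rwa [weylBasis_apply, weylBasis_apply] at this
  have hone : α 1 = 1 := by
    rw [← weyl_zero ψ, hα, zero_vecMul]
  have hmul : ∀ A B, α (A * B) = α A * α B := by
    -- It suffices to compare products of basis elements, where invariance of the form keeps the
    -- Heisenberg cocycle unchanged.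
    have := (LinearMap.map_mul_iff
      (α : Module.End ℂ ((Fin n → F) → ℂ) →ₗ[ℂ] Module.End ℂ ((Fin n → F) → ℂ))).2
      (b.ext fun u => b.ext fun v => by
        simp only [LinearMap.compr₂_apply, LinearMap.compl₂_apply, LinearMap.comp_apply,
          LinearMap.mul_apply', LinearEquiv.coe_coe, b, weylBasis_apply, weyl_mul' h2, map_smul,
          hα, sympForm_vecMul, add_vecMul])
    exact this
  exact ⟨AlgEquiv.ofLinearEquiv α hone hmul, hα⟩

/-- Every symplectic matrix is implemented by an invertible operator. -/
theorem exists_implementer [Finite F] (h2 : (2 : F) ≠ 0) {ψ : AddChar F ℂ} (hψ : ψ ≠ 1)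
    (g : Sp n F) :
    ∃ M : Module.End ℂ ((Fin n → F) → ℂ), IsUnit M ∧
      ∀ v, weyl ψ v * M = M * weyl ψ (v ᵥ* (g : Matrix (Fin n ⊕ Fin n) (Fin n ⊕ Fin n) F)) := by
  obtain ⟨α, hα⟩ := exists_algEquiv_weyl h2 hψ g
  -- Skolem–Noether: `α` is conjugation by `T`.
  obtain ⟨T, rfl⟩ := α.eq_linearEquivConjAlgEquiv
  refine ⟨T.symm, (Module.End.isUnit_iff _).2 T.symm.bijective, fun v => ?_⟩
  rw [← hα, LinearEquiv.conjAlgEquiv_apply]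
  ext f
  simp

/-- Implementers of the same symplectic matrix are proportional. -/
theorem implementer_unique [Finite F] {ψ : AddChar F ℂ} (hψ : ψ ≠ 1)
    {e : (Fin n ⊕ Fin n → F) → (Fin n ⊕ Fin n → F)} {M N : Module.End ℂ ((Fin n → F) → ℂ)}
    (hM : IsUnit M) (hMe : ∀ v, weyl ψ v * M = M * weyl ψ (e v))
    (hNe : ∀ v, weyl ψ v * N = N * weyl ψ (e v)) : ∃ c : ℂ, N = c • M := by
  obtain ⟨U, rfl⟩ := hM
  obtain ⟨c, hc⟩ := eq_smul_one_of_commute_weyl hψ (A := N * (↑U⁻¹ : Module.End ℂ ((Fin n → F) → ℂ))) fun v => by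
    have : weyl ψ (e v) * (↑U⁻¹ : Module.End ℂ ((Fin n → F) → ℂ)) = ↑U⁻¹ * weyl ψ v := by
      rw [Units.mul_inv_eq_iff_eq_mul, mul_assoc, hMe v, Units.inv_mul_cancel_left]
    rw [Commute, SemiconjBy, ← mul_assoc, hNe, mul_assoc, mul_assoc, this]
  refine ⟨c, ?_⟩
  rw [← Units.inv_mul_cancel_right N U, hc, smul_mul_assoc, one_mul]

/-- The parity operator `f(t) ↦ f(-t)`. -/
def parity (n : ℕ) (F : Type u) [Field F] : Module.End ℂ ((Fin n → F) → ℂ) :=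
  LinearMap.funLeft ℂ ℂ Neg.neg

theorem parity_apply (f : (Fin n → F) → ℂ) (t : Fin n → F) : parity n F f t = f (-t) := rfl

theorem parity_mul_parity : parity n F * parity n F = 1 :=
  LinearMap.ext fun f => funext fun t => by simp [parity_apply]

theorem weyl_mul_parity (ψ : AddChar F ℂ) (v : Fin n ⊕ Fin n → F) :
    weyl ψ v * parity n F = parity n F * weyl ψ (-v) := by
  refine LinearMap.ext fun f => funext fun t => ?_
  have e : ∀ i : Fin n → Fin n ⊕ Fin n, (-v) ∘ i = -(v ∘ i) := fun _ => rfl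
  simp [parity_apply, weyl_apply, e, ← sub_eq_neg_add]

/-- The trace of a permutation operator counts fixed points, and `-t = t` only for `t = 0`. -/
theorem trace_parity [Finite F] (h2 : (2 : F) ≠ 0) :
    LinearMap.trace ℂ _ (parity n F) = 1 := by
  classical
  have := Fintype.ofFinite F
  have h : ∀ t : Fin n → F, -t = t ↔ t = 0 := fun t => by
    refine ⟨fun ht => funext fun i => ?_, fun ht => by simp [ht]⟩
    have : 2 * t i = 0 := by
      have := congrFun ht i
      simp only [Pi.neg_apply] at this
      linear_combination -this
    simpa [h2] using this
  rw [LinearMap.trace_eq_matrix_trace ℂ (Pi.basisFun ℂ (Fin n → F)), Matrix.trace]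
  simp [parity_apply, Pi.single_apply, h]

/-- Conjugating `M` by parity gives another implementer of `g`, because `-I` is central; so it
equals `c • M`. Comparing traces in `P = c • (M P M⁻¹)` forces `c = 1`, as the trace of `P` is
nonzero. -/
theorem commute_parity [Finite F] (h2 : (2 : F) ≠ 0) {ψ : AddChar F ℂ} (hψ : ψ ≠ 1)
    {g : Sp n F} {M : Module.End ℂ ((Fin n → F) → ℂ)} (hM : IsUnit M)
    (hMg : ∀ v, weyl ψ v * M =
      M * weyl ψ (v ᵥ* (g : Matrix (Fin n ⊕ Fin n) (Fin n ⊕ Fin n) F))) :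
    Commute M (parity n F) := by
  obtain ⟨c, hc⟩ := implementer_unique hψ hM hMg (N := parity n F * M * parity n F) fun v => by
    rw [← mul_assoc, ← mul_assoc, weyl_mul_parity, mul_assoc (parity n F), hMg, mul_assoc,
      mul_assoc, weyl_mul_parity, neg_vecMul, neg_neg]
    simp only [mul_assoc]
  obtain ⟨U, rfl⟩ := hM
  have h1 : (parity n F) * U = c • (U * parity n F) := by
    rw [← smul_mul_assoc, ← hc, mul_assoc _ (parity n F), parity_mul_parity, mul_one]
  have h3 : parity n F = c • (U * parity n F * ↑U⁻¹) := by
    rw [← smul_mul_assoc, ← h1, Units.mul_inv_cancel_right]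
  have hc1 : c = 1 := by
    have := congrArg (LinearMap.trace ℂ _) h3
    rw [map_smul, LinearMap.trace_mul_comm, Units.inv_mul_cancel_left, trace_parity h2] at this
    simpa using this.symm
  rw [hc1, one_smul] at h1
  exact h1.symm

/-- The Weil representation exists. -/
theorem exists_isWeilRepresentation [Finite F] (h2 : (2 : F) ≠ 0) {ψ : AddChar F ℂ}
    (hψ : ψ ≠ 1) :
    ∃ W : Representation ℂ (Sp n F) ((Fin n → F) → ℂ), IsWeilRepresentation ψ W := by
  choose M hM hMg using fun g : Sp n F => exists_implementer h2 hψ g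
  obtain ⟨W, hW⟩ := exists_linearization parity_mul_parity (trace_parity h2) M hM
    (fun g => commute_parity h2 hψ (hM g) (hMg g)) fun g h =>
      implementer_unique hψ (hM (g * h)) (hMg (g * h)) fun v => by
        rw [← mul_assoc, hMg, mul_assoc, hMg, vecMul_vecMul, ← mul_assoc, Submonoid.coe_mul]
  refine ⟨W, fun g v => ?_⟩
  obtain ⟨c, hc⟩ := hW g
  rw [hc, LinearMap.comp_smul, LinearMap.smul_comp]
  exact congrArg (c • ·) (hMg g v)

end Weyl

/-! ### The direct product and maximality of `G` -/

section Subgroups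

variable {n : ℕ} {F : Type u} [Field F]

theorem Sp.negOne_mul_negOne : Sp.negOne n F * Sp.negOne n F = 1 :=
  Subtype.ext (by simp [Sp.negOne])

theorem Sp.negOne_mul_comm (g : Sp n F) : Sp.negOne n F * g = g * Sp.negOne n F :=
  Subtype.ext (by simp [Sp.negOne])

theorem Sp.mem_zpowers_negOne {g : Sp n F} (hg : g ∈ Subgroup.zpowers (Sp.negOne n F)) :
    g = 1 ∨ g = Sp.negOne n F := by
  obtain ⟨k, rfl⟩ := Subgroup.mem_zpowers_iff.1 hg
  obtain ⟨m, rfl | rfl⟩ := Int.even_or_odd' k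
  · left; rw [_root_.zpow_mul, zpow_ofNat, sq, Sp.negOne_mul_negOne, _root_.one_zpow]
  · right; rw [_root_.zpow_add_one, _root_.zpow_mul, zpow_ofNat, sq, Sp.negOne_mul_negOne,
      _root_.one_zpow, one_mul]

theorem Sp.unip_mem_G {Q : Matrix (Fin n) (Fin n) F} (hQ : Q.IsSymm) :
    Sp.unip Q hQ ∈ Sp.G n F :=
  Subgroup.mem_sup_right (show Sp.unip Q hQ ∈ Sp.B n F from ⟨Q, hQ, rfl⟩)

theorem Sp.negOne_mem_G : Sp.negOne n F ∈ Sp.G n F :=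
  Subgroup.mem_sup_left (Subgroup.mem_zpowers _)

theorem Sp.disjoint_negOne_B (h2 : (2 : F) ≠ 0) (hn : 1 ≤ n) :
    Disjoint (Subgroup.zpowers (Sp.negOne n F)) (Sp.B n F) := by
  rw [Subgroup.disjoint_def]
  rintro g hg ⟨Q, hQ, hgQ⟩
  rcases Sp.mem_zpowers_negOne hg with rfl | rfl
  · rfl
  · have h := congrFun (congrFun (congrArg Subtype.val hgQ) (Sum.inl ⟨0, hn⟩)) (Sum.inl ⟨0, hn⟩)
    have h' : (-1 : F) = 1 := by simpa [Sp.negOne, Sp.unip] using h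
    exact absurd (by linear_combination -h') h2

theorem Sp.B_mul_comm {g h : Sp n F} (hg : g ∈ Sp.B n F) (hh : h ∈ Sp.B n F) :
    g * h = h * g := by
  obtain ⟨Q, hQ, rfl⟩ := hg
  obtain ⟨R, hR, rfl⟩ := hh
  exact Subtype.ext (by simp [Sp.unip, fromBlocks_multiply, add_comm])

theorem Sp.G_le_centralizer : Sp.G n F ≤ Subgroup.centralizer (Sp.G n F) := by
  have hB : Sp.G n F ≤ Subgroup.centralizer (Sp.B n F) := by
    refine sup_le ?_ fun g hg => Subgroup.mem_centralizer_iff.2 fun h hh => Sp.B_mul_comm hh hg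
    rw [Subgroup.zpowers_le, Subgroup.mem_centralizer_iff]
    exact fun h _ => (Sp.negOne_mul_comm h).symm
  rw [Subgroup.le_centralizer_iff]
  refine sup_le ?_ (Subgroup.le_centralizer_iff.1 hB)
  rw [Subgroup.zpowers_le, Subgroup.mem_centralizer_iff]
  exact fun h _ => (Sp.negOne_mul_comm h).symm

instance Sp.isMulCommutative_G : IsMulCommutative (Sp.G n F) :=
  isMulCommutative_iff.2 fun a b => Subtype.ext
    (Subgroup.mem_centralizer_iff.1 (Sp.G_le_centralizer b.2) a a.2)

/-- A matrix that commutes with all symmetric matrices is scalar. -/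
theorem Matrix.mem_range_scalar_of_commute_isSymm {a : Matrix (Fin n) (Fin n) F}
    (ha : ∀ Q : Matrix (Fin n) (Fin n) F, Q.IsSymm → Commute Q a) :
    a ∈ Set.range (Matrix.scalar (Fin n)) := by
  refine mem_range_scalar_of_commute_single fun i j hij => ?_
  have h1 : (single i i (1 : F)).IsSymm := by simp [IsSymm]
  have h2 : (single i j (1 : F) + single j i 1).IsSymm := by simp [IsSymm, add_comm]
  -- The product of these two symmetric matrices is the matrix unit `E_ij`.
  have := (ha _ h1).mul_left (ha _ h2)
  rwa [mul_add, single_mul_single_same, single_mul_single_of_ne _ _ _ _ hij, add_zero,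
    one_mul] at this

/-- The centralizer of `B` is contained in `G`. -/
theorem Sp.mem_G_of_commute (hn : 1 ≤ n) {g : Sp n F}
    (hg : ∀ (Q : Matrix (Fin n) (Fin n) F) (hQ : Q.IsSymm),
      Sp.unip Q hQ * g = g * Sp.unip Q hQ) : g ∈ Sp.G n F := by
  obtain ⟨A, hA⟩ := g
  obtain ⟨a, b, c, d, rfl⟩ : ∃ a b c d, A = fromBlocks a b c d :=
    ⟨_, _, _, _, (fromBlocks_toBlocks A).symm⟩
  have key : ∀ Q : Matrix (Fin n) (Fin n) F, Q.IsSymm → b * Q = 0 ∧ Q * a = d * Q := by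
    intro Q hQ
    have h := congrArg Subtype.val (hg Q hQ)
    simp only [Sp.unip, Submonoid.mk_mul_mk, fromBlocks_multiply, fromBlocks_inj] at h
    obtain ⟨h1, -, h3, -⟩ := h
    constructor
    · simpa using h1
    · simpa [add_comm] using h3
  -- `Q = 1` gives `b = 0` and `a = d`; then `a` commutes with every symmetric `Q`, so it is a
  -- scalar `α`.
  obtain ⟨hb, had⟩ := key 1 isSymm_one
  rw [mul_one] at hb
  rw [one_mul, mul_one] at had
  subst hb had
  obtain ⟨α, rfl⟩ := mem_range_scalar_of_commute_isSymm fun Q hQ => (key Q hQ).2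
  have hA' := SymplecticGroup.mem_iff.1 hA
  simp only [Matrix.J, fromBlocks_transpose, fromBlocks_multiply, fromBlocks_inj] at hA'
  obtain ⟨-, -, h3, h4⟩ := hA'
  have hα : α * α = 1 := by
    have := congrFun (congrFun h3 ⟨0, hn⟩) ⟨0, hn⟩
    simpa using this
  have hα0 : α ≠ 0 := by rintro rfl; simp at hα
  have hc : c.IsSymm := by
    refine IsSymm.ext fun i j => ?_
    have := congrFun (congrFun h4 i) j
    have e : α * c j i = c i j * α := by simpa [← sub_eq_add_neg, sub_eq_zero] using this
    exact mul_left_cancel₀ hα0 (e.trans (mul_comm _ _))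
  rcases mul_self_eq_one_iff.1 hα with rfl | rfl
  · convert Sp.unip_mem_G hc
    simp [Sp.unip]
  · convert Subgroup.mul_mem _ Sp.negOne_mem_G (Sp.unip_mem_G hc.neg)
    simp only [Sp.unip, Sp.negOne, Submonoid.mk_mul_mk, neg_mul, one_mul, fromBlocks_neg, neg_zero,
      neg_neg, map_neg, map_one]

theorem Sp.maximal_G (hn : 1 ≤ n) :
    Maximal (fun H : Subgroup (Sp n F) => IsMulCommutative H) (Sp.G n F) := by
  refine ⟨Sp.isMulCommutative_G, fun H hH hle g hg => Sp.mem_G_of_commute hn fun Q hQ => ?_⟩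
  have : IsMulCommutative H := hH
  exact setLike_mul_comm (hle (Sp.unip_mem_G hQ)) hg

end Subgroups

/-! ### Restriction of a Weil representation to `G` -/

section WeilRestriction

variable {n : ℕ} {F : Type u} [Field F]

/-- A vector is determined up to sign by the values of all quadratic forms. -/
theorem eq_or_eq_neg_of_forall_isSymm (h2 : (2 : F) ≠ 0) {ψ : AddChar F ℂ} (hψ : ψ ≠ 1)
    {s t : Fin n → F}
    (h : ∀ Q : Matrix (Fin n) (Fin n) F, Q.IsSymm →
      ψ (-(2⁻¹ * ((s ᵥ* Q) ⬝ᵥ s))) = ψ (-(2⁻¹ * ((t ᵥ* Q) ⬝ᵥ t)))) :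
    s = t ∨ s = -t := by
  have key : ∀ i j, s i * s j = t i * t j := by
    intro i j
    refine neg_injective (AddChar.to_mulShift_inj_of_isPrimitive
      (AddChar.IsPrimitive.of_ne_one hψ) (DFunLike.ext _ _ fun a => ?_))
    -- On this `Q` half the quadratic form is `a * r i * r j`, also when `i = j`; letting `a` vary
    -- recovers `r i * r j` from `ψ`.
    have hQ : (single i j a + single j i a).IsSymm := by simp [IsSymm, add_comm]
    have e : ∀ r : Fin n → F,
        -(2⁻¹ * ((r ᵥ* (single i j a + single j i a)) ⬝ᵥ r)) = -(r i * r j) * a := by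
      intro r
      have : ∀ i j : Fin n, (r ᵥ* single i j a) ⬝ᵥ r = r i * a * r j := fun i j => by
        rw [← dotProduct_mulVec]; simp [single_mulVec, dotProduct, Function.update_apply]; ring
      rw [vecMul_add, add_dotProduct, this, this]
      field_simp
      ring
    have := h _ hQ
    rwa [e, e] at this
  by_cases hs : s = 0
  · left
    funext i
    have := key i i
    simp only [hs, Pi.zero_apply, mul_zero] at this
    simpa [hs] using (mul_self_eq_zero.1 this.symm).symm
  · obtain ⟨k, hk⟩ := Function.ne_iff.1 hs
    have hk : s k ≠ 0 := hk
    rcases mul_self_eq_mul_self_iff.1 (key k k) with e | e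
    · left
      funext i
      have := key i k
      rw [← e] at this
      exact mul_right_cancel₀ hk this
    · right
      funext i
      have := key i k
      rw [← neg_eq_iff_eq_neg] at e
      rw [← e, mul_neg, ← neg_mul] at this
      exact mul_right_cancel₀ hk this

variable {ψ : AddChar F ℂ} {W : Representation ℂ (Sp n F) ((Fin n → F) → ℂ)}

theorem Representation.apply_ne_zero {k G V : Type*} [Field k] [Group G] [AddCommGroup V]
    [Module k V] [Nontrivial V] (ρ : Representation k G V) (g : G) : ρ g ≠ 0 := fun h => by
  have := map_mul ρ g g⁻¹
  rw [mul_inv_cancel, map_one, h, zero_mul] at this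
  exact one_ne_zero this

/-- A Weil representation maps `-I` to a multiple of the parity operator. -/
theorem IsWeilRepresentation.negOne_eq [Finite F] (hψ : ψ ≠ 1) (hW : IsWeilRepresentation ψ W) :
    ∃ c : ℂ, c ≠ 0 ∧ W (Sp.negOne n F) = c • parity n F := by
  obtain ⟨c, hc⟩ := implementer_unique hψ (IsUnit.of_mul_eq_one _ parity_mul_parity)
    (weyl_mul_parity ψ) (N := W (Sp.negOne n F)) fun v => by
      have := hW (Sp.negOne n F) v
      simpa [Sp.negOne, vecMul_neg, Module.End.mul_eq_comp] using this
  refine ⟨c, ?_, hc⟩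
  rintro rfl
  exact W.apply_ne_zero _ (hc.trans (zero_smul _ _))

/-- A Weil representation maps `g_Q` to a multiplication operator. -/
theorem IsWeilRepresentation.unip_apply_eq_mul [Finite F] (hψ : ψ ≠ 1)
    (hW : IsWeilRepresentation ψ W) {Q : Matrix (Fin n) (Fin n) F} (hQ : Q.IsSymm) :
    ∃ m : (Fin n → F) → ℂ, ∀ f t, W (Sp.unip Q hQ) f t = m t * f t := by
  classical
  have := Fintype.ofFinite F
  -- `g_Q` fixes every `(x, 0)`, and the operators `T_(x, 0)` span the diagonal matrix units.
  have hx : ∀ x : Fin n → F, Commute (weyl ψ (Sum.elim x 0)) (W (Sp.unip Q hQ)) := by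
    intro x
    have := hW (Sp.unip Q hQ) (Sum.elim x 0)
    have e : Sum.elim x 0 ᵥ* ((Sp.unip Q hQ : Sp n F) : Matrix (Fin n ⊕ Fin n) (Fin n ⊕ Fin n) F) =
        Sum.elim x 0 := by
      simp [Sp.unip, vecMul_fromBlocks]
    rwa [e] at this
  have hc : (Fintype.card (Fin n → F) : ℂ) ≠ 0 := Nat.cast_ne_zero.2 Fintype.card_ne_zero
  have hE : ∀ t : Fin n → F, Commute (matrixUnit t t) (W (Sp.unip Q hQ)) := by
    intro t
    have : Commute ((Fintype.card (Fin n → F) : ℂ) • matrixUnit t t) (W (Sp.unip Q hQ)) := by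
      rw [card_smul_matrixUnit hψ, sub_self]
      exact Commute.sum_left _ _ _ fun x _ => (hx x).smul_left _
    simpa [smul_smul, inv_mul_cancel₀ hc] using this.smul_left (Fintype.card (Fin n → F) : ℂ)⁻¹
  refine ⟨fun t => W (Sp.unip Q hQ) (Pi.single t 1) t, fun f t => ?_⟩
  have := congrFun (LinearMap.congr_fun (hE t).eq f) t
  have e : matrixUnit t t f = f t • Pi.single t (1 : ℂ) := by
    rw [← Pi.single_smul', smul_eq_mul, mul_one]
    simp [matrixUnit]
  simp only [Module.End.mul_apply, e, map_smul, Pi.smul_apply, smul_eq_mul] at this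
  rw [mul_comm, ← this]
  simp [matrixUnit]

/-- The action of `g_Q` in a Weil representation. -/
theorem IsWeilRepresentation.unip_apply [Finite F] (hψ : ψ ≠ 1)
    (hW : IsWeilRepresentation ψ W) {Q : Matrix (Fin n) (Fin n) F} (hQ : Q.IsSymm) :
    ∃ c : ℂ, c ≠ 0 ∧ ∀ f t, W (Sp.unip Q hQ) f t = c * ψ (-(2⁻¹ * ((t ᵥ* Q) ⬝ᵥ t))) * f t := by
  obtain ⟨m, hm⟩ := hW.unip_apply_eq_mul hψ hQ
  have hms : ∀ s, m s = m 0 * ψ (-(2⁻¹ * ((s ᵥ* Q) ⬝ᵥ s))) := by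
    intro s
    -- Translation by `-s` moves the value at `s` to the point `0`; applied to the constant function
    -- `1`, the intertwining relation then expresses `m s` through `m 0`.
    have h := congrFun (LinearMap.congr_fun (hW (Sp.unip Q hQ) (Sum.elim 0 (-s))) 1) 0
    have e : Sum.elim 0 (-s) ᵥ* ((Sp.unip Q hQ : Sp n F) : Matrix (Fin n ⊕ Fin n) (Fin n ⊕ Fin n) F) =
        Sum.elim (-s ᵥ* Q) (-s) := by
      simp [Sp.unip, vecMul_fromBlocks]
    rw [e] at h
    simpa [weyl_apply, hm, neg_vecMul] using h
  refine ⟨m 0, fun h0 => ?_, fun f t => by rw [hm, hms]⟩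
  refine W.apply_ne_zero (Sp.unip Q hQ) (LinearMap.ext fun f => funext fun t => ?_)
  simp [hm, hms t, h0]

/-- A common eigenvector of `G` is determined among those with the same eigenvalues by its value
at a single point of the support. -/
theorem IsWeilRepresentation.eq_zero_of_eigenvector [Finite F] (h2 : (2 : F) ≠ 0) (hψ : ψ ≠ 1)
    (hW : IsWeilRepresentation ψ W) (χ : Sp n F → ℂ) {φ η : (Fin n → F) → ℂ}
    (hφ : ∀ g ∈ Sp.G n F, W g φ = χ g • φ) (hη : ∀ g ∈ Sp.G n F, W g η = χ g • η)
    {s : Fin n → F} (hs : φ s ≠ 0) (hs' : η s = 0) : η = 0 := by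
  funext t
  by_contra ht
  have ht : η t ≠ 0 := ht
  have hst : s = t ∨ s = -t := by
    refine eq_or_eq_neg_of_forall_isSymm h2 hψ fun Q hQ => ?_
    obtain ⟨c, hc, hcW⟩ := hW.unip_apply hψ hQ
    have h₁ := congrFun (hφ _ (Sp.unip_mem_G hQ)) s
    have h₂ := congrFun (hη _ (Sp.unip_mem_G hQ)) t
    rw [hcW, Pi.smul_apply, smul_eq_mul] at h₁ h₂
    exact mul_left_cancel₀ hc ((mul_right_cancel₀ hs h₁).trans (mul_right_cancel₀ ht h₂).symm)
  rcases hst with rfl | rfl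
  · exact ht hs'
  -- The eigenvector equation for `-I`, evaluated at `-t = s` where `η` vanishes, forces `η t = 0`.
  · obtain ⟨c, hc, hcW⟩ := hW.negOne_eq hψ
    have h := congrFun (hη _ Sp.negOne_mem_G) (-t)
    rw [hcW, LinearMap.smul_apply, Pi.smul_apply, Pi.smul_apply, parity_apply, neg_neg, hs',
      smul_zero] at h
    exact (smul_ne_zero hc ht) h

/-- Every Weil representation is multiplicity free on `G`. -/
theorem IsWeilRepresentation.isMultiplicityFree [Finite F] (h2 : (2 : F) ≠ 0) (hψ : ψ ≠ 1)
    (hW : IsWeilRepresentation ψ W) : IsMultiplicityFree (W.comp (Sp.G n F).subtype) := by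
  classical
  intro E _ _ σ hσ ⟨f, hf⟩
  have hinj : Function.Injective f := (hσ.injective_or_eq_zero f).resolve_right hf
  have : FiniteDimensional ℂ E := FiniteDimensional.of_injective f.toLinearMap hinj
  have hone : Module.finrank ℂ E = 1 := hσ.finrank_eq_one_of_isMulCommutative
  obtain ⟨e, he, hspan⟩ := finrank_eq_one_iff'.1 hone
  choose χ hχ using fun g => hspan (σ g e)
  -- The character of `G` on the line `E` is extended by zero to the whole symplectic group.
  have heig : ∀ (h : Representation.IntertwiningMap σ (W.comp (Sp.G n F).subtype)),
      ∀ g (hg : g ∈ Sp.G n F), W g (h e) = (if hg : g ∈ Sp.G n F then χ ⟨g, hg⟩ else 0) • h e := by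
    intro h g hg
    have := LinearMap.congr_fun (h.isIntertwining' ⟨g, hg⟩) e
    rw [dif_pos hg]
    refine this.symm.trans ?_
    change h (σ ⟨g, hg⟩ e) = _
    rw [← hχ, map_smul]
  have hfe : f e ≠ 0 := fun h => he (hinj (h.trans (map_zero f).symm))
  obtain ⟨s, hs⟩ := Function.ne_iff.1 hfe
  have hs : f e s ≠ 0 := hs
  -- The scalar makes `h - c • f` vanish at `e` and the point `s`; hence it kills `e`, and so is
  -- zero by irreducibility.
  refine finrank_eq_one_iff'.2 ⟨f, hf, fun h => ⟨h e s / f e s, ?_⟩⟩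
  have h0 := hW.eq_zero_of_eigenvector h2 hψ _ (heig f) (heig (h - (h e s / f e s) • f)) hs
    (by simp [div_mul_cancel₀ _ hs])
  refine (sub_eq_zero.1 (((hσ.injective_or_eq_zero _).resolve_left fun hi => ?_))).symm
  exact he (hi (h0.trans (map_zero _).symm))

end WeilRestriction

theorem theorem2p1 {F : Type u} [Field F] [Finite F] (hF : ringChar F ≠ 2) (n : ℕ) (hn : 1 ≤ n)
    (ψ : AddChar F ℂ) (hψ : ψ ≠ 1) :
    -- `G` is the internal direct product of `⟨-I⟩` and `B`
    Disjoint (Subgroup.zpowers (Sp.negOne n F)) (Sp.B n F) ∧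
    -- `G` is a maximal abelian subgroup
    Maximal (fun H : Subgroup (Sp n F) => IsMulCommutative H) (Sp.G n F) ∧
    -- there is a Weil representation, and each one is multiplicity free on `G`
    (∃ W : Representation ℂ (Sp n F) ((Fin n → F) → ℂ), IsWeilRepresentation ψ W) ∧
    ∀ W : Representation ℂ (Sp n F) ((Fin n → F) → ℂ), IsWeilRepresentation ψ W →
      IsMultiplicityFree (W.comp (Sp.G n F).subtype) := by
  have h2 : (2 : F) ≠ 0 := Ring.two_ne_zero hF
  exact ⟨Sp.disjoint_negOne_B h2 hn, Sp.maximal_G hn, exists_isWeilRepresentation h2 hψ,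
    fun W hW => hW.isMultiplicityFree h2 hψ⟩
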